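/- Let $n$ be a non-negative integer, $N=\{1,\dots,n\}$, $\hat N=\{1,\dots,n+1\}$, let $c_1,\dots,c_n$ be non-negative integers, and let $\prec$ be a linear order on $N$ such that $i\prec j$ implies $c_i\le c_j$. Write $\mathbf c$ for these data. The canonical $S$-graph $\mathscr G(\mathbf c)$, whose vertices are labelled by elements of $\hat N$ and whose edges are labelled by elements of $N$, depends only on $\prec$ and is defined by induction on $n$ (binary fusion). For $n=0$ it is a single vertex with label $1$. For $n\ge 1$ let $s$ be the $\prec$-maximal element of $N$, and let $\mathscr G'$ be the canonical $S$-graph of $N\setminus\{s\}$ with the induced order, identified with $\{1,\dots,n-1\}$ by the increasing bijection. Let $\mathscr G^+$ be the copy of $\mathscr G'$ in which all vertex labels and edge labels $\ge s$ are increased by $1$. Let $\mathscr G^-$ be a second copy, with isomorphism $\varphi:\mathscr G^+\to\mathscr G^-$ preserving all labels, except that $\varphi(v)$ has label $s$ if $v$ has label $s+1$. Then $\mathscr G(\mathbf c)$ is the disjoint union of $\mathscr G^+$ and $\mathscr G^-$, together with an edge with label $s$ joining $v$ to $\varphi(v)$ for each vertex $v$ of $\mathscr G^+$ with label $s+1$.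 This graph is connected. It contains a unique pointed chain, that is, a sequence of vertices $p_1,\dots,p_{n+1}$ such that $p_k$ has label $k$ for all $k\in\hat N$, and $p_k,p_{k+1}$ are joined by an edge with label $k$ for all $k\in N$. The vertex $p_{n+1}$ is called the distinguished vertex. Let $r^1,\dots,r^{n+1}$ be the coordinate functions on $\mathbb Q^{n+1}$. There is a unique family of linear functions $z_v$ on $\mathbb Q^{n+1}$, $v$ running over the vertices of $\mathscr G(\mathbf c)$, such that $z_v=0$ for the distinguished vertex $v$, and $$z_v-z_{v'}=c_t\,(r^k-r^\ell)$$ whenever $v$, $v'$ have labels $k$, $\ell$ and are joined by an edge with label $t$. Set $Z(\mathbf c)=\{z_v : v\in V(\mathscr G(\mathbf c))\}$. For a subset $S$ of a rational vector space, let $E(S)$ denote the set of its extreme points, that is, the set of all $x\in S$ with the following property: whenever $x=\sum_{y\in F}a_y\,y$ with $F\subseteq S$ finite and rational numbers $a_y>0$ satisfying $\sum_{y\in F}a_y=1$, one has $y=x$ for all $y\in F$. **Corollary 3.4.** Every element of $Z(\mathbf c)$ is an extreme point of $Z(\mathbf c)$, i.e. $$Z(\mathbf c)=E(Z(\mathbf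 c)).$$ -/

import Mathlib

/-- A graph of order `n`: its vertices are labelled by `{1, …, n + 1}` (here `Fin (n + 1)`), its
edges by `{1, …, n}` (here `Fin n`); `edge r v w` says that `v` and `w` are joined by an edge
with label `r`. -/
structure LabelledGraph (n : ℕ) where
  V : Type
  label : V → Fin (n + 1)
  edge : Fin n → V → V → Prop

namespace LabelledGraph

/-- The graph with one vertex and no edges. -/
def point : LabelledGraph 0 where
  V := Unit
  label _ := 0
  edge _ _ _ := False

/-- The edges of the binary fusion of `G` at `s`: those of the two copies `G⁺` (`Sum.inl`) and
`G⁻` (`Sum.inr`) of `G`, whose labels `≥ s` are raised by one, and an edge with label `s` between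
each vertex of `G⁺` with (new) label `s + 1` and the corresponding vertex of `G⁻`.
On vertex labels, `s.castSucc.succAbove` raises the labels `≥ s` by one
(so that `s` is missing on `G⁺`). -/
inductive FusionEdge {n : ℕ} (G : LabelledGraph n) (s : Fin (n + 1)) :
    Fin (n + 1) → G.V ⊕ G.V → G.V ⊕ G.V → Prop
  | plus (r : Fin n) (v w : G.V) : G.edge r v w →
      FusionEdge G s (s.succAbove r) (Sum.inl v) (Sum.inl w)
  | minus (r : Fin n) (v w : G.V) : G.edge r v w →
      FusionEdge G s (s.succAbove r) (Sum.inr v) (Sum.inr w)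
  | across (v : G.V) : s.castSucc.succAbove (G.label v) = s.succ →
      FusionEdge G s s (Sum.inl v) (Sum.inr v)
  | across_symm (v : G.V) : s.castSucc.succAbove (G.label v) = s.succ →
      FusionEdge G s s (Sum.inr v) (Sum.inl v)

/-- The binary fusion of `G` at `s`: the union of `G⁺` and `G⁻`. The vertex of `G⁻` corresponding
to `v` in `G⁺` has the same label as `v`, except that the label `s + 1` is replaced by `s`. -/
abbrev fusion {n : ℕ} (G : LabelledGraph n) (s : Fin (n + 1)) : LabelledGraph (n + 1) where
  V := G.V ⊕ G.V
  label := Sum.elim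
    (fun v => s.castSucc.succAbove (G.label v))
    (fun v => if s.castSucc.succAbove (G.label v) = s.succ then s.castSucc
      else s.castSucc.succAbove (G.label v))
  edge := FusionEdge G s

/-- The maximal element of `Fin (n + 1)` with respect to `prec`
(unique when `prec` is a strict linear order). -/
noncomputable def maxElt {n : ℕ} (prec : Fin (n + 1) → Fin (n + 1) → Prop) : Fin (n + 1) :=
  Classical.epsilon fun s => ∀ j, j ≠ s → prec j s

/-- The canonical `S`-graph attached to a linear order `prec` on `{1, …, n}`: delete the maximal
element `s`, close up the gap, take the canonical graph of the induced order on `n - 1` elements,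
and apply binary fusion at `s`. -/
noncomputable def canonical : (n : ℕ) → (Fin n → Fin n → Prop) → LabelledGraph n
  | 0, _ => point
  | n + 1, prec =>
    (canonical n fun i j => prec ((maxElt prec).succAbove i) ((maxElt prec).succAbove j)).fusion
      (maxElt prec)

/-- A pointed chain: vertices `p 1, …, p (n + 1)` with `p k` of label `k`, where `p k` and
`p (k + 1)` are joined by an edge with label `k`. Its vertex with label `n + 1` is the
distinguished vertex. -/
def IsPointedChain {n : ℕ} (G : LabelledGraph n) (p : Fin (n + 1) → G.V) : Prop :=
  (∀ k, G.label (p k) = k) ∧ ∀ r : Fin n, G.edge r (p r.castSucc) (p r.succ)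

end LabelledGraph

/-- The function `r^j`: the `j`-th coordinate function on an `(n + 1)`-dimensional space. -/
abbrev kashiwara {n : ℕ} (j : Fin (n + 1)) : Module.Dual ℚ (Fin (n + 1) → ℚ) :=
  LinearMap.proj j

/-- An evaluation of `G` with zero driving function: a linear function `z v` for each vertex `v`,
zero at the distinguished vertex, with `z v - z w = c_r (r^k - r^l)` whenever `v`, `w` have labels
`k`, `l` and are joined by an edge with label `r`. -/
structure IsEvaluation {n : ℕ} (G : LabelledGraph n) (c : Fin n → ℕ)
    (z : G.V → Module.Dual ℚ (Fin (n + 1) → ℚ)) : Prop where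
  driving : ∀ p, G.IsPointedChain p → z (p (Fin.last n)) = 0
  edge : ∀ r v w, G.edge r v w →
    z v - z w = (c r : ℚ) • (kashiwara (G.label v) - kashiwara (G.label w))

namespace LabelledGraph

theorem fusion_label_inr {n : ℕ} (G : LabelledGraph n) (s : Fin (n + 1)) (v : G.V) :
    (G.fusion s).label (Sum.inr v) = s.succ.succAbove (G.label v) := by
  simp only [Sum.elim_inr]
  generalize G.label v = l
  ext
  simp only [Fin.succAbove, Fin.lt_def, Fin.ext_iff]
  split_ifs <;> simp_all <;> omega

theorem pointedChain_fusion {n : ℕ} {G : LabelledGraph n} (s : Fin (n + 1))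
    {p : Fin (n + 1) → G.V} (hp : G.IsPointedChain p) :
    ∃ q, (G.fusion s).IsPointedChain q := by
  obtain ⟨q, q1, q2⟩ : ∃ q : Fin (n + 2) → G.V ⊕ G.V,
      (∀ (m : ℕ) (h : m ≤ s), q ⟨m, by omega⟩ = Sum.inr (p ⟨m, by omega⟩)) ∧
      ∀ (m : ℕ) (h : (s : ℕ) ≤ m) (hm : m < n + 1), q ⟨m + 1, by omega⟩ = Sum.inl (p ⟨m, hm⟩) := by
    refine ⟨fun k => if h : (k : ℕ) ≤ s then Sum.inr (p ⟨k, by omega⟩)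
      else Sum.inl (p ⟨k - 1, by omega⟩), fun m h => dif_pos h, fun m h hm => ?_⟩
    exact dif_neg (by simp only; omega)
  refine ⟨q, fun k => ?_, fun r => ?_⟩
  · by_cases h : (k : ℕ) ≤ s
    · have e := q1 k h
      simp only [Fin.eta] at e
      rw [e, fusion_label_inr, hp.1]
      ext
      simp only [Fin.succAbove, Fin.lt_def]
      split_ifs <;> simp_all
    · obtain ⟨k, hk⟩ := k
      obtain ⟨m, rfl⟩ : ∃ m, k = m + 1 := ⟨k - 1, by simp only at h; omega⟩
      simp only at h
      rw [q2 m (by omega) (by omega)]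
      change s.castSucc.succAbove (G.label _) = _
      rw [hp.1]
      ext
      simp only [Fin.succAbove, Fin.lt_def]
      split_ifs <;> simp_all <;> omega
  · change FusionEdge G s r (q ⟨r, by omega⟩) (q ⟨r + 1, by omega⟩)
    rcases lt_trichotomy (r : ℕ) s with h | h | h
    · rw [q1 r h.le, q1 (r + 1) h]
      have hr : (r : ℕ) < n := by omega
      have := FusionEdge.minus (s := s) ⟨r, hr⟩ _ _ (hp.2 ⟨r, hr⟩)
      have e : s.succAbove ⟨r, hr⟩ = r := by
        ext
        simp [Fin.succAbove, Fin.lt_def, h]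
      rw [e] at this
      exact this
    · obtain rfl : r = s := Fin.ext h
      rw [q1 r le_rfl, q2 r le_rfl r.2]
      refine FusionEdge.across_symm _ ?_
      rw [hp.1]
      exact Fin.succAbove_castSucc_self r
    · obtain ⟨r, hr⟩ := r
      obtain ⟨m, rfl⟩ : ∃ m, r = m + 1 := ⟨r - 1, by simp only at h; omega⟩
      simp only at h
      rw [q2 m (by omega) (by omega), q2 (m + 1) (by omega) hr]
      have := FusionEdge.plus (s := s) ⟨m, by omega⟩ _ _ (hp.2 ⟨m, by omega⟩)
      have e : s.succAbove ⟨m, by omega⟩ = ⟨m + 1, hr⟩ := by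
        ext
        simp only [Fin.succAbove, Fin.lt_def]
        split_ifs <;> simp_all <;> omega
      rw [e] at this
      exact this

theorem fusionEdge_sideways {n : ℕ} {G : LabelledGraph n} {s r : Fin (n + 1)} {a b : G.V ⊕ G.V}
    (h : FusionEdge G s r a b) (hr : r ≠ s) :
    (a.isLeft = b.isLeft) ∧ ∀ t, s.succAbove t = r →
      G.edge t (Sum.elim id id a) (Sum.elim id id b) := by
  cases h with
  | plus r v w h =>
    exact ⟨rfl, fun t ht => by rw [Fin.succAbove_right_injective ht]; exact h⟩
  | minus r v w h =>
    exact ⟨rfl, fun t ht => by rw [Fin.succAbove_right_injective ht]; exact h⟩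
  | across => exact absurd rfl hr
  | across_symm => exact absurd rfl hr

theorem fusionEdge_across {n : ℕ} {G : LabelledGraph n} {s r : Fin (n + 1)} {a b : G.V ⊕ G.V}
    (h : FusionEdge G s r a b) (hr : r = s) :
    (Sum.elim id id a : G.V) = Sum.elim id id b := by
  cases h with
  | plus r v w h => exact absurd hr (Fin.succAbove_ne _ _)
  | minus r v w h => exact absurd hr (Fin.succAbove_ne _ _)
  | across => rfl
  | across_symm => rfl

theorem pointedChain_of_fusion {n : ℕ} {G : LabelledGraph n} (s : Fin (n + 1))
    {q : Fin (n + 2) → (G.fusion s).V} (hq : (G.fusion s).IsPointedChain q) :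
    ∃ p, G.IsPointedChain p ∧ q (Fin.last (n + 1)) = Sum.inl (p (Fin.last n)) := by
  obtain ⟨hl, he⟩ := hq
  have hs : Sum.isLeft (q s.succ) = true := by
    have := hl s.succ
    match hv : q s.succ with
    | Sum.inl v => rfl
    | Sum.inr v =>
      rw [hv, fusion_label_inr] at this
      exact absurd this (Fin.succAbove_ne _ _)
  have hleft : ∀ (m : ℕ) (hm : m < n + 2), (s : ℕ) + 1 ≤ m → Sum.isLeft (q ⟨m, hm⟩) = true := by
    intro m hm h
    induction m, h using Nat.le_induction with
    | base => exact hs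
    | succ m h ih =>
      have := (fusionEdge_sideways (he ⟨m, by omega⟩)
        (by simp only [ne_eq, Fin.ext_iff]; omega)).1
      exact this.symm.trans (ih (by omega))
  have hlast : ∀ k, s.castSucc.succAbove k = Fin.last (n + 1) ↔ k = Fin.last n := by
    intro k
    simp only [Fin.succAbove, Fin.lt_def, Fin.ext_iff]
    split_ifs <;> simp_all
    omega
  refine ⟨fun k => Sum.elim id id (q (s.castSucc.succAbove k)), ⟨fun k => ?_, fun r => ?_⟩, ?_⟩
  · have h1 := hl (s.castSucc.succAbove k)
    dsimp only
    by_cases hk : k = s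
    · subst hk
      have e : k.castSucc.succAbove k = k.succ := Fin.succAbove_castSucc_self k
      rw [e] at h1 ⊢
      match hv : q k.succ with
      | Sum.inl v =>
        rw [hv] at h1
        exact Fin.succAbove_right_injective (p := k.castSucc) (h1.trans e.symm)
      | Sum.inr v => rw [hv] at hs; cases hs
    · match hv : q (s.castSucc.succAbove k) with
      | Sum.inl v =>
        rw [hv] at h1
        exact Fin.succAbove_right_injective h1
      | Sum.inr v =>
        rw [hv, fusion_label_inr] at h1
        have e : s.castSucc.succAbove k = s.succ.succAbove k := by
          ext
          simp only [Fin.ext_iff] at hk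
          simp only [Fin.succAbove, Fin.lt_def]
          split_ifs <;> simp_all <;> omega
        rw [e] at h1
        exact Fin.succAbove_right_injective h1
  · have h := (fusionEdge_sideways (he (s.succAbove r)) (Fin.succAbove_ne _ _)).2 r rfl
    have hx := fusionEdge_across (he s) rfl
    have e1 : s.castSucc.succAbove r.castSucc = (s.succAbove r).castSucc := by
      ext
      simp only [Fin.succAbove, Fin.lt_def]
      split_ifs <;> simp_all <;> omega
    rw [← e1] at h
    by_cases hrs : (r : ℕ) + 1 = s
    · have e2 : (s.succAbove r).succ = s.castSucc := by
        ext
        simp only [Fin.succAbove, Fin.lt_def]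
        split_ifs <;> simp_all <;> omega
      have e3 : s.castSucc.succAbove r.succ = s.succ := by
        ext
        simp only [Fin.succAbove, Fin.lt_def]
        split_ifs <;> simp_all
      rw [e2, hx, ← e3] at h
      exact h
    · have e2 : s.castSucc.succAbove r.succ = (s.succAbove r).succ := by
        ext
        simp only [Fin.succAbove, Fin.lt_def]
        split_ifs <;> simp_all <;> omega
      rw [← e2] at h
      exact h
  · dsimp only
    rw [(hlast _).2 rfl]
    have := hleft (n + 1) (by omega) (by omega)
    match hv : q (Fin.last (n + 1)) with
    | Sum.inl v => rfl
    | Sum.inr v =>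
      change Sum.isLeft (q (Fin.last (n + 1))) = true at this
      rw [hv] at this; cases this

end LabelledGraph


theorem canonical_pointedChain : ∀ (n : ℕ) (prec : Fin n → Fin n → Prop),
    ∃ p, (LabelledGraph.canonical n prec).IsPointedChain p
  | 0, _ => ⟨fun _ => (), fun k => (Fin.fin_one_eq_zero k).symm, fun r => r.elim0⟩
  | n + 1, prec => by
    obtain ⟨p, hp⟩ := canonical_pointedChain n fun i j =>
      prec ((LabelledGraph.maxElt prec).succAbove i) ((LabelledGraph.maxElt prec).succAbove j)
    exact LabelledGraph.pointedChain_fusion (LabelledGraph.maxElt prec) hp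

theorem canonical_pointedChain_last : ∀ (n : ℕ) (prec : Fin n → Fin n → Prop)
    (p q : Fin (n + 1) → (LabelledGraph.canonical n prec).V),
    (LabelledGraph.canonical n prec).IsPointedChain p →
    (LabelledGraph.canonical n prec).IsPointedChain q → p (Fin.last n) = q (Fin.last n)
  | 0, _, _, _, _, _ => rfl
  | n + 1, prec, p, q, hp, hq => by
    obtain ⟨p', hp', ep⟩ := LabelledGraph.pointedChain_of_fusion (LabelledGraph.maxElt prec) hp
    obtain ⟨q', hq', eq⟩ := LabelledGraph.pointedChain_of_fusion (LabelledGraph.maxElt prec) hq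
    exact (ep.trans (congrArg Sum.inl (canonical_pointedChain_last n _ p' q' hp' hq'))).trans
      eq.symm

theorem canonical_connected {M : Type} : ∀ (n : ℕ) (prec : Fin n → Fin n → Prop)
    (d : (LabelledGraph.canonical n prec).V → M),
    (∀ r v w, (LabelledGraph.canonical n prec).edge r v w → d v = d w) → ∀ v w, d v = d w
  | 0, _, _, _, _, _ => rfl
  | n + 1, prec, d, hd, v, w => by
    have h1 := canonical_connected n _ (fun v => d (Sum.inl v))
      fun r v w h => hd _ _ _ (LabelledGraph.FusionEdge.plus r v w h)
    have h2 := canonical_connected n _ (fun v => d (Sum.inr v))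
      fun r v w h => hd _ _ _ (LabelledGraph.FusionEdge.minus r v w h)
    obtain ⟨p, hp⟩ := canonical_pointedChain n fun i j =>
      prec ((LabelledGraph.maxElt prec).succAbove i) ((LabelledGraph.maxElt prec).succAbove j)
    have h3 := hd _ _ _ (LabelledGraph.FusionEdge.across (p (LabelledGraph.maxElt prec))
      (by rw [hp.1]; exact Fin.succAbove_castSucc_self _))
    have h4 : ∀ v w, d (Sum.inl v) = d (Sum.inr w) := fun v w =>
      ((h1 _ _).trans h3).trans (h2 _ _)
    match v, w with
    | Sum.inl v, Sum.inl w => exact h1 v w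
    | Sum.inr v, Sum.inr w => exact h2 v w
    | Sum.inl v, Sum.inr w => exact h4 v w
    | Sum.inr v, Sum.inl w => exact (h4 w v).symm

theorem canonical_exists_evaluation : ∀ (n : ℕ) (prec : Fin n → Fin n → Prop) (c : Fin n → ℕ),
    ∃ z, IsEvaluation (LabelledGraph.canonical n prec) c z ∧
      ∀ v w, (LabelledGraph.canonical n prec).label v = (LabelledGraph.canonical n prec).label w →
        z v (Pi.single ((LabelledGraph.canonical n prec).label v) 1) =
          z w (Pi.single ((LabelledGraph.canonical n prec).label w) 1)
  | 0, _, _ => ⟨fun _ => 0, ⟨fun _ _ => rfl, fun r => r.elim0⟩, fun _ _ _ => rfl⟩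
  | n + 1, prec, c => by
    obtain ⟨z, hz, hc⟩ := canonical_exists_evaluation n
      (fun i j => prec ((LabelledGraph.maxElt prec).succAbove i)
        ((LabelledGraph.maxElt prec).succAbove j))
      (fun i => c ((LabelledGraph.maxElt prec).succAbove i))
    obtain ⟨p, hp⟩ := canonical_pointedChain n fun i j =>
      prec ((LabelledGraph.maxElt prec).succAbove i) ((LabelledGraph.maxElt prec).succAbove j)
    change ∃ z, IsEvaluation ((LabelledGraph.canonical n fun i j =>
      prec ((LabelledGraph.maxElt prec).succAbove i)
        ((LabelledGraph.maxElt prec).succAbove j)).fusion (LabelledGraph.maxElt prec)) c z ∧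
      ∀ v w, ((LabelledGraph.canonical n _).fusion _).label v =
        ((LabelledGraph.canonical n _).fusion _).label w →
        z v (Pi.single (((LabelledGraph.canonical n _).fusion _).label v) 1) =
          z w (Pi.single (((LabelledGraph.canonical n _).fusion _).label w) 1)
    generalize LabelledGraph.maxElt prec = s at *
    generalize LabelledGraph.canonical n (fun i j => prec (s.succAbove i) (s.succAbove j)) = G at *
    set e : ℚ := z (p s) (Pi.single s 1) with he
    have hes : ∀ v, G.label v = s → z v (Pi.single s 1) = e := fun v hv => by
      have := hc v (p s) (by rw [hv, hp.1])
      rwa [hv, hp.1] at this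
    have hsingle : ∀ (t : Fin (n + 2)) (a : Fin (n + 1)),
        LinearMap.funLeft ℚ ℚ t.succAbove (Pi.single (t.succAbove a) 1) = Pi.single a 1 := by
      intro t a
      ext k
      simp [LinearMap.funLeft_apply, Pi.single_apply]
    refine ⟨Sum.elim (fun v => z v ∘ₗ LinearMap.funLeft ℚ ℚ s.castSucc.succAbove)
      (fun v => z v ∘ₗ LinearMap.funLeft ℚ ℚ s.succ.succAbove +
        ((c s : ℚ) - e) • (kashiwara s.castSucc - kashiwara s.succ)), ⟨?_, ?_⟩, ?_⟩
    · intro q hq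
      obtain ⟨p', hp', e'⟩ := LabelledGraph.pointedChain_of_fusion s hq
      rw [e']
      simp only [Sum.elim_inl, hz.driving p' hp', LinearMap.zero_comp]
    · intro r v w h
      have key : ∀ b : Fin (n + 2) → ℚ, ∀ v, G.label v = s →
          z v (LinearMap.funLeft ℚ ℚ s.castSucc.succAbove b) -
            z v (LinearMap.funLeft ℚ ℚ s.succ.succAbove b) = (b s.succ - b s.castSucc) * e := by
        intro b v hv
        rw [← hes v hv, ← map_sub, ← smul_eq_mul, ← map_smul]
        congr 1
        ext k
        simp only [LinearMap.funLeft_apply, Pi.sub_apply, Pi.smul_apply, Pi.single_apply,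
          smul_eq_mul]
        by_cases hk : k = s
        · subst hk
          rw [Fin.succAbove_castSucc_self, Fin.succAbove_succ_self]
          simp
        · have : s.castSucc.succAbove k = s.succ.succAbove k := by
            ext
            simp only [Fin.ext_iff] at hk
            simp only [Fin.succAbove, Fin.lt_def]
            split_ifs <;> simp_all <;> omega
          rw [this]
          simp [hk]
      have hlab : ∀ v, s.castSucc.succAbove (G.label v) = s.succ → G.label v = s := fun v h =>
        Fin.succAbove_right_injective (h.trans (Fin.succAbove_castSucc_self s).symm)
      have hlabr : ∀ v, G.label v = s → (G.fusion s).label (Sum.inr v) = s.castSucc := fun v h => by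
        rw [LabelledGraph.fusion_label_inr, h, Fin.succAbove_succ_self]
      have hlabl : ∀ v, (G.fusion s).label (Sum.inl v) = s.castSucc.succAbove (G.label v) :=
        fun _ => rfl
      cases h with
      | plus r v w h =>
        refine LinearMap.ext fun b => ?_
        have := LinearMap.congr_fun (hz.edge r v w h)
          (LinearMap.funLeft ℚ ℚ s.castSucc.succAbove b)
        exact this
      | minus r v w h =>
        rw [LabelledGraph.fusion_label_inr, LabelledGraph.fusion_label_inr, Sum.elim_inr,
          Sum.elim_inr, add_sub_add_right_eq_sub]
        refine LinearMap.ext fun b => ?_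
        have := LinearMap.congr_fun (hz.edge r v w h)
          (LinearMap.funLeft ℚ ℚ s.succ.succAbove b)
        exact this
      | across v h =>
        rw [hlabr v (hlab v h), hlabl, h]
        refine LinearMap.ext fun b => ?_
        have := key b v (hlab v h)
        simp only [Sum.elim_inl, Sum.elim_inr, LinearMap.sub_apply, LinearMap.add_apply,
          LinearMap.comp_apply, LinearMap.smul_apply, LinearMap.proj_apply, smul_eq_mul]
        linear_combination this
      | across_symm v h =>
        rw [hlabr v (hlab v h), hlabl, h]
        refine LinearMap.ext fun b => ?_
        have := key b v (hlab v h)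
        simp only [Sum.elim_inl, Sum.elim_inr, LinearMap.sub_apply, LinearMap.add_apply,
          LinearMap.comp_apply, LinearMap.smul_apply, LinearMap.proj_apply, smul_eq_mul]
        linear_combination -this
    · have hlr : ∀ v w, s.castSucc.succAbove (G.label v) = s.succ.succAbove (G.label w) →
          z v (Pi.single (G.label v) 1) = z w (Pi.single (G.label w) 1) + ((c s : ℚ) - e) *
            ((Pi.single (s.succ.succAbove (G.label w)) 1 : Fin (n + 2) → ℚ) s.castSucc -
             (Pi.single (s.succ.succAbove (G.label w)) 1 : Fin (n + 2) → ℚ) s.succ) := by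
        intro v w h
        have hvw : G.label v = G.label w := by
          revert h
          simp only [Fin.succAbove, Fin.lt_def, Fin.ext_iff]
          split_ifs <;> simp_all <;> omega
        have n1 : s.castSucc ≠ s.succ.succAbove (G.label w) := by
          rw [← h]
          exact (Fin.succAbove_ne _ _).symm
        have n2 : s.succ ≠ s.succ.succAbove (G.label w) := (Fin.succAbove_ne _ _).symm
        rw [Pi.single_eq_of_ne n1, Pi.single_eq_of_ne n2, hc v w hvw]
        ring
      rintro (v | v) (w | w) h
      · change s.castSucc.succAbove (G.label v) = s.castSucc.succAbove (G.label w) at h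
        change z v (LinearMap.funLeft ℚ ℚ _ (Pi.single (s.castSucc.succAbove (G.label v)) 1)) =
          z w (LinearMap.funLeft ℚ ℚ _ (Pi.single (s.castSucc.succAbove (G.label w)) 1))
        rw [hsingle, hsingle]
        exact hc v w (Fin.succAbove_right_injective h)
      · rw [LabelledGraph.fusion_label_inr] at h ⊢
        change z v (LinearMap.funLeft ℚ ℚ _ (Pi.single (s.castSucc.succAbove (G.label v)) 1)) =
          z w (LinearMap.funLeft ℚ ℚ _ (Pi.single (s.succ.succAbove (G.label w)) 1)) + _
        rw [hsingle, hsingle]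
        exact hlr v w h
      · rw [LabelledGraph.fusion_label_inr] at h ⊢
        change z v (LinearMap.funLeft ℚ ℚ _ (Pi.single (s.succ.succAbove (G.label v)) 1)) + _ =
          z w (LinearMap.funLeft ℚ ℚ _ (Pi.single (s.castSucc.succAbove (G.label w)) 1))
        rw [hsingle, hsingle]
        exact (hlr w v h.symm).symm
      · rw [LabelledGraph.fusion_label_inr, LabelledGraph.fusion_label_inr] at h ⊢
        have hvw := Fin.succAbove_right_injective h
        change z v (LinearMap.funLeft ℚ ℚ _ (Pi.single (s.succ.succAbove (G.label v)) 1)) + _ =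
          z w (LinearMap.funLeft ℚ ℚ _ (Pi.single (s.succ.succAbove (G.label w)) 1)) + _
        rw [hsingle, hsingle, hc v w hvw, hvw]

/-- The canonical graph admits a unique evaluation with zero driving function. -/
theorem canonical_existsUnique_evaluation (n : ℕ) (prec : Fin n → Fin n → Prop) (c : Fin n → ℕ) :
    ∃! z, IsEvaluation (LabelledGraph.canonical n prec) c z := by
  obtain ⟨z, hz, -⟩ := canonical_exists_evaluation n prec c
  obtain ⟨p, hp⟩ := canonical_pointedChain n prec
  refine ⟨z, hz, fun z' hz' => funext fun v => ?_⟩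
  have := canonical_connected n prec (fun v => z' v - z v) (fun r v w h => by
    have h1 := hz.edge r v w h
    have h2 := hz'.edge r v w h
    exact sub_eq_sub_iff_sub_eq_sub.2 (h2.trans h1.symm)) v (p (Fin.last n))
  simp only [hz.driving p hp, hz'.driving p hp, sub_self] at this
  exact sub_eq_zero.1 this

/-- The linear functions `z v` attached to the vertices `v` of the canonical graph. -/
noncomputable def evaluation {n : ℕ} (prec : Fin n → Fin n → Prop) (c : Fin n → ℕ) :
    (LabelledGraph.canonical n prec).V → Module.Dual ℚ (Fin (n + 1) → ℚ) :=
  (canonical_existsUnique_evaluation n prec c).choose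

/-- The `S`-set `Z(c)`, where `prec` is the linear order carried by `c`. -/
def canonicalSSet {n : ℕ} (prec : Fin n → Fin n → Prop) (c : Fin n → ℕ) :
    Set (Module.Dual ℚ (Fin (n + 1) → ℚ)) :=
  Set.range (evaluation prec c)

/-- The extremal points of a (not necessarily convex) subset `S` of a rational vector space: the
points of `S` that are not a convex combination, with positive coefficients, of a finite set of
points of `S` other than the trivial one. -/
def extremalPoints {E : Type*} [AddCommGroup E] [Module ℚ E] (S : Set E) : Set E :=
  {x | x ∈ S ∧ ∀ (F : Finset E) (a : E → ℚ), (∀ y ∈ F, y ∈ S) → (∀ y ∈ F, 0 < a y) →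
    ∑ y ∈ F, a y = 1 → ∑ y ∈ F, a y • y = x → ∀ y ∈ F, y = x}

/-! Induction on `n`, undoing one binary fusion at a time. Setting `r^s = r^(s + 1)` kills the
contribution `c_s (r^s - r^(s + 1))` of the edges between `G⁺` and `G⁻` and turns both relabellings
back into the labels of `G`. So `mergeCoords s` gives corresponding vertices of the two copies the
same value, and these common values form an evaluation of `G`, to which the induction hypothesis
applies.

The fibres of this restriction are small. No vertex of `G⁺` has label `s`, so the coefficient of
`r^s` is constant on `G⁺`; likewise that of `r^(s + 1)` is constant on `G⁻`. By
`dual_ext_of_mergeCoords` each copy then contributes at most one point to a fibre, so a fibre has at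
most two points.

This suffices by `subset_extremalPoints_of_fiber`: a convex combination equal to `x` maps to one
equal to the extreme point `f x`, so it is supported in the fibre of `x`, and a positive weight on
the only other possible point would move the sum away from `x`. -/

/-! ### Extreme points and linear maps with small fibres -/

/-- Extremality of all points lifts along a linear map whose fibres have at most two points. -/
theorem subset_extremalPoints_of_fiber {E E' : Type*} [AddCommGroup E] [Module ℚ E]
    [AddCommGroup E'] [Module ℚ E'] (f : E →ₗ[ℚ] E') {S : Set E} {T : Set E'}
    (hf : ∀ x ∈ S, f x ∈ T) (hT : T ⊆ extremalPoints T)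
    (hfib : ∀ x ∈ S, ∀ y ∈ S, ∀ w ∈ S, f y = f x → f w = f x → y = x ∨ w = x ∨ y = w) :
    S ⊆ extremalPoints S := by
  classical
  intro x hx
  refine ⟨hx, fun F a hF ha hsum hxF y hy => ?_⟩
  have hfx : ∀ y ∈ F, f y = f x := by
    intro y hy
    -- Push the convex combination forward: the weight of an image point is the total weight of the
    -- points of `F` above it.
    refine (hT (hf x hx)).2 (F.image f) (fun u => ∑ y ∈ F with f y = u, a y) ?_ ?_ ?_ ?_ (f y)
      (Finset.mem_image_of_mem f hy)
    · intro u hu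
      obtain ⟨y, hy, rfl⟩ := Finset.mem_image.1 hu
      exact hf y (hF y hy)
    · intro u hu
      obtain ⟨y, hy, rfl⟩ := Finset.mem_image.1 hu
      exact Finset.sum_pos (fun w hw => ha w (Finset.mem_filter.1 hw).1)
        ⟨y, Finset.mem_filter.2 ⟨hy, rfl⟩⟩
    · rw [Finset.sum_fiberwise_of_maps_to (fun y hy => Finset.mem_image_of_mem f hy), hsum]
    · rw [← hxF, map_sum, ← Finset.sum_fiberwise_of_maps_to
        (fun y hy => Finset.mem_image_of_mem f hy)]
      refine Finset.sum_congr rfl fun u _ => ?_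
      rw [Finset.sum_smul]
      refine Finset.sum_congr rfl fun w hw => ?_
      rw [map_smul, (Finset.mem_filter.1 hw).2]
  by_contra hne
  have hzero : ∑ w ∈ F, a w • (w - x) = 0 := by
    simp only [smul_sub, Finset.sum_sub_distrib, hxF, ← Finset.sum_smul, hsum, one_smul, sub_self]
  -- Only `y` can contribute: any other element of `F` equals `x`, since the fibre has no third
  -- point.
  rw [Finset.sum_eq_single_of_mem y hy] at hzero
  · exact (smul_ne_zero (ha y hy).ne' (sub_ne_zero.2 hne)) hzero
  · intro w hw hwy
    rcases hfib x hx y (hF y hy) w (hF w hw) (hfx y hy) (hfx w hw) with h | h | h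
    · exact absurd h hne
    · rw [h, sub_self, smul_zero]
    · exact absurd h.symm hwy

/-! ### Merging two adjacent coordinates -/

/-- Restriction of linear functions to the hyperplane `r^s = r^(s + 1)`. -/
def mergeCoords {n : ℕ} (s : Fin (n + 1)) :
    Module.Dual ℚ (Fin (n + 2) → ℚ) →ₗ[ℚ] Module.Dual ℚ (Fin (n + 1) → ℚ) :=
  (LinearMap.funLeft ℚ ℚ s.predAbove).dualMap

theorem mergeCoords_kashiwara {n : ℕ} (s : Fin (n + 1)) (j : Fin (n + 2)) :
    mergeCoords s (kashiwara j) = kashiwara (s.predAbove j) := rfl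

/-- A linear function is determined by its restriction to `r^s = r^(s + 1)` and one of its
coefficients at `r^s` and `r^(s + 1)`. -/
theorem dual_ext_of_mergeCoords {n : ℕ} {s : Fin (n + 1)} {t : Fin (n + 2)}
    (ht : s.predAbove t = s) {x y : Module.Dual ℚ (Fin (n + 2) → ℚ)}
    (h : mergeCoords s x = mergeCoords s y)
    (hxy : x (Pi.single t 1) = y (Pi.single t 1)) : x = y := by
  have hm : ∀ b : Fin (n + 1) → ℚ, x (b ∘ s.predAbove) = y (b ∘ s.predAbove) :=
    fun b => LinearMap.congr_fun h b
  -- The indices merged into `s` are exactly `j` and `t`, so the restriction knows the sum of these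
  -- two coefficients, and the one at `t` yields the other.
  have hne : ∀ j : Fin (n + 2), j ≠ t → s.predAbove j = s →
      (Pi.single s 1 : Fin (n + 1) → ℚ) ∘ s.predAbove =
        (Pi.single j 1 + Pi.single t 1 : Fin (n + 2) → ℚ) := by
    intro j hj hjs
    ext k
    have hk : s.predAbove k = s ↔ k = j ∨ k = t := by
      simp only [Fin.predAbove, Fin.lt_def, Fin.ext_iff, ne_eq] at *
      split_ifs at * <;> simp_all <;> omega
    simp only [Function.comp_apply, Pi.add_apply, Pi.single_apply, hk]
    by_cases h1 : k = j
    · simp [h1, hj]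
    · simp [h1]
  refine LinearMap.pi_ext' fun j => LinearMap.ext_ring ?_
  change x (Pi.single j 1) = y (Pi.single j 1)
  by_cases hj : j = t
  · rw [hj, hxy]
  by_cases hjs : s.predAbove j = s
  · have := hm (Pi.single s 1)
    rw [hne j hj hjs, map_add, map_add, hxy] at this
    exact add_right_cancel this
  · have e : (Pi.single j 1 : Fin (n + 2) → ℚ) =
        (Pi.single (s.predAbove j) 1 : Fin (n + 1) → ℚ) ∘ s.predAbove := by
      ext k
      have hk : s.predAbove k = s.predAbove j ↔ k = j := by
        simp only [Fin.predAbove, Fin.lt_def, Fin.ext_iff, Fin.val_castSucc] at *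
        split_ifs at * <;> simp only [Fin.val_pred, Fin.coe_castPred] at * <;> omega
      simp only [Function.comp_apply, Pi.single_apply, hk]
    rw [e, hm]

/-! ### The fusion step -/

/-- Binary fusion preserves the property that all values of an evaluation are extremal. -/
theorem range_subset_extremalPoints_fusion {n : ℕ} {G : LabelledGraph n} (s : Fin (n + 1))
    (c : Fin (n + 1) → ℕ) {p : Fin (n + 1) → G.V} (hp : G.IsPointedChain p)
    (hlast : ∀ p q, G.IsPointedChain p → G.IsPointedChain q → p (Fin.last n) = q (Fin.last n))
    (hconn : ∀ {M : Type} (d : G.V → M), (∀ r v w, G.edge r v w → d v = d w) → ∀ v w, d v = d w)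
    (ih : ∀ z, IsEvaluation G (fun i => c (s.succAbove i)) z →
      Set.range z ⊆ extremalPoints (Set.range z))
    {z : G.V ⊕ G.V → Module.Dual ℚ (Fin (n + 2) → ℚ)} (hz : IsEvaluation (G.fusion s) c z) :
    Set.range z ⊆ extremalPoints (Set.range z) := by
  have hplus : ∀ r v w, G.edge r v w → z (Sum.inl v) - z (Sum.inl w) = (c (s.succAbove r) : ℚ) •
      (kashiwara (s.castSucc.succAbove (G.label v)) -
        kashiwara (s.castSucc.succAbove (G.label w))) := fun r v w h =>
    hz.edge _ _ _ (.plus r v w h)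
  have hminus : ∀ r v w, G.edge r v w → z (Sum.inr v) - z (Sum.inr w) = (c (s.succAbove r) : ℚ) •
      (kashiwara (s.succ.succAbove (G.label v)) -
        kashiwara (s.succ.succAbove (G.label w))) := fun r v w h => by
    have := hz.edge _ _ _ (.minus r v w h)
    rwa [LabelledGraph.fusion_label_inr, LabelledGraph.fusion_label_inr] at this
  -- The distinguished vertex of the fusion is the copy in `G⁺` of that of `G`.
  have hp0 : z (Sum.inl (p (Fin.last n))) = 0 := by
    obtain ⟨q, hq⟩ := LabelledGraph.pointedChain_fusion s hp
    obtain ⟨p', hp', e⟩ := LabelledGraph.pointedChain_of_fusion s hq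
    have := hz.driving q hq
    rwa [e, hlast p' p hp' hp] at this
  have pred1 : ∀ a, s.predAbove (s.castSucc.succAbove a) = a := fun a => by simp
  have pred2 : ∀ a, s.predAbove (s.succ.succAbove a) = a := fun a => by
    simp only [Fin.succAbove, Fin.predAbove, Fin.lt_def, Fin.ext_iff, Fin.val_castSucc,
      apply_dite Fin.val, Fin.val_pred, Fin.coe_castPred, dite_eq_ite, apply_ite Fin.val,
      Fin.val_succ]
    split_ifs <;> omega
  have hmplus : IsEvaluation G (fun i => c (s.succAbove i))
      (fun v => mergeCoords s (z (Sum.inl v))) := by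
    refine ⟨fun q hq => ?_, fun r v w h => ?_⟩
    · rw [hlast q p hq hp, hp0, map_zero]
    · rw [← map_sub, hplus r v w h, map_smul, map_sub, mergeCoords_kashiwara,
        mergeCoords_kashiwara, pred1, pred1]
  -- After merging, both copies obey the same edge relations, so their difference is constant by
  -- connectedness. It vanishes at `p s`, whose copies have labels `s + 1` and `s` and are joined by
  -- an edge.
  have hmerge : ∀ v, mergeCoords s (z (Sum.inr v)) = mergeCoords s (z (Sum.inl v)) := by
    intro v
    have hps : s.castSucc.succAbove (G.label (p s)) = s.succ := by
      rw [hp.1]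
      exact Fin.succAbove_castSucc_self s
    have h0 : mergeCoords s (z (Sum.inr (p s)) - z (Sum.inl (p s))) = 0 := by
      have := hz.edge _ _ _ (.across_symm (p s) hps)
      rw [LabelledGraph.fusion_label_inr, hp.1, Fin.succAbove_succ_self] at this
      rw [this]
      simp only [Sum.elim_inl, hps, map_smul, map_sub, mergeCoords_kashiwara]
      simp
    have := hconn (fun v => mergeCoords s (z (Sum.inr v) - z (Sum.inl v)))
      (fun r v w h => by
        rw [← sub_eq_zero, ← map_sub, sub_sub_sub_comm, hplus r v w h, hminus r v w h]
        simp only [map_smul, map_sub, mergeCoords_kashiwara, pred1, pred2, sub_self]) v (p s)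
    rw [← sub_eq_zero, ← map_sub]
    exact this.trans h0
  -- `succAbove` skips `s` on `G⁺`, so no edge relation there involves `r^s`.
  have hcplus : ∀ v w, z (Sum.inl v) (Pi.single s.castSucc 1) =
      z (Sum.inl w) (Pi.single s.castSucc 1) := by
    refine hconn (fun v => z (Sum.inl v) (Pi.single s.castSucc 1)) fun r v w h => ?_
    rw [← sub_eq_zero, ← LinearMap.sub_apply, hplus r v w h]
    simp [Fin.succAbove_ne]
  have hcminus : ∀ v w, z (Sum.inr v) (Pi.single s.succ 1) =
      z (Sum.inr w) (Pi.single s.succ 1) := by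
    refine hconn (fun v => z (Sum.inr v) (Pi.single s.succ 1)) fun r v w h => ?_
    rw [← sub_eq_zero, ← LinearMap.sub_apply, hminus r v w h]
    simp [Fin.succAbove_ne]
  have hinl : ∀ v w, mergeCoords s (z (Sum.inl v)) = mergeCoords s (z (Sum.inl w)) →
      z (Sum.inl v) = z (Sum.inl w) := fun v w h =>
    dual_ext_of_mergeCoords (t := s.castSucc) (by simp) h (hcplus v w)
  have hinr : ∀ v w, mergeCoords s (z (Sum.inr v)) = mergeCoords s (z (Sum.inr w)) →
      z (Sum.inr v) = z (Sum.inr w) := fun v w h =>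
    dual_ext_of_mergeCoords (t := s.succ) (by simp) h (hcminus v w)
  refine subset_extremalPoints_of_fiber (mergeCoords s) ?_ (ih _ hmplus) ?_
  · rintro _ ⟨v | v, rfl⟩
    · exact ⟨v, rfl⟩
    · exact ⟨v, (hmerge v).symm⟩
  · rintro _ ⟨u, rfl⟩ _ ⟨v, rfl⟩ _ ⟨w, rfl⟩ hv hw
    -- Of three vertices, two lie in the same copy, where equal restrictions force equal values.
    match u, v, w with
    | Sum.inl u, Sum.inl v, _ => exact .inl (hinl v u hv)
    | Sum.inr u, Sum.inr v, _ => exact .inl (hinr v u hv)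
    | Sum.inl u, Sum.inr v, Sum.inl w => exact .inr (.inl (hinl w u hw))
    | Sum.inl u, Sum.inr v, Sum.inr w => exact .inr (.inr (hinr v w (hv.trans hw.symm)))
    | Sum.inr u, Sum.inl v, Sum.inr w => exact .inr (.inl (hinr w u hw))
    | Sum.inr u, Sum.inl v, Sum.inl w => exact .inr (.inr (hinl v w (hv.trans hw.symm)))

/-! ### Induction on the order of the graph -/

/-- Allowing any evaluation `z` lets the induction hypothesis apply directly to the merged values on
`G⁺`, without identifying them with the chosen `evaluation`. For `n = 0` there is a single vertex,
hence a single value. -/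
theorem range_evaluation_subset_extremalPoints : ∀ (n : ℕ) (prec : Fin n → Fin n → Prop)
    (c : Fin n → ℕ) (z : (LabelledGraph.canonical n prec).V → Module.Dual ℚ (Fin (n + 1) → ℚ)),
    IsEvaluation (LabelledGraph.canonical n prec) c z → Set.range z ⊆ extremalPoints (Set.range z)
  | 0, _, _, z, _ => by
    rintro _ ⟨v, rfl⟩
    refine ⟨⟨v, rfl⟩, fun F a hF _ _ _ y hy => ?_⟩
    obtain ⟨w, rfl⟩ := hF y hy
    rfl
  | n + 1, _, c, _, hz =>
    have ⟨_, hp⟩ := canonical_pointedChain n _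
    range_subset_extremalPoints_fusion _ c hp (canonical_pointedChain_last n _)
      (canonical_connected n _) (range_evaluation_subset_extremalPoints n _ _) hz

theorem corollary3p4 (n : ℕ) (c : Fin n → ℕ) (prec : Fin n → Fin n → Prop)
    (hprec : IsStrictTotalOrder (Fin n) prec) (hc : ∀ i j, prec i j → c i ≤ c j) :
    canonicalSSet prec c = extremalPoints (canonicalSSet prec c) :=
  (range_evaluation_subset_extremalPoints n prec c _
    (canonical_existsUnique_evaluation n prec c).choose_spec.1).antisymm fun _ h => h.1
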